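/- Let $\lambda>0$, $\beta\in(0,1]$ and $\kappa\in[0,1)$. Let $E_\beta(z)=\sum_{n\ge0} z^n/\Gamma(\beta n+1)$ be the Mittag-Leffler function, let $\pi_{\lambda,\beta}=\sum_{k\ge0}\frac{\lambda^k}{k!}E_\beta^{(k)}(-\lambda)\,\delta_k$ be the fractional Poisson measure on $\mathbb R$, with Laplace transform $l(z)=\int e^{zx}\,d\pi_{\lambda,\beta}(x)$, and let $\mathrm e(z;x)=e^{zx}/l(z)$ be the Wick exponential. Let $C_n$ be the generalized Appell polynomials, $C_n(x)=\frac{d^n}{dz^n}\mathrm e(\log(1+z);x)\big|_{z=0}$, so that $\mathrm e(\log(1+z);\cdot)=\sum_{n}\frac{z^n}{n!}C_n$ and $\mathrm e(w;\cdot)=\sum_{n}\frac{(e^w-1)^n}{n!}C_n$ for small $z,w$; for all other complex $z,w$ these series define the left-hand sides as elements of the test space $(N)^{\kappa}$ of all formal series $\sum_n\varphi_nC_n$ with $\sum_n(n!)^{1+\kappa}2^{nq}|\varphi_n|^2<\infty$ for all $q\in\mathbb N_0$. Let $Q_k$ be the functionals $\langle\varphi,Q_k\rangle=\int(\Delta^k\varphi)(x)\,d\pi_{\lambda,\beta}(x)$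 on polynomials, where $(\Delta\varphi)(x)=\varphi(x+1)-\varphi(x)$. Every linear functional $\Phi$ on polynomials is uniquely $\Phi=\sum_n\Phi_nQ_n$, where $\Phi_n=\langle C_n,\Phi\rangle/n!$. Let $(H)_{-q}^{-\kappa}$, $q\in\mathbb N_0$, be the space of those $\Phi$ with $\|\Phi\|_{-q,-\kappa}^2=\sum_n(n!)^{1-\kappa}2^{-nq}|\Phi_n|^2<\infty$, and let $(N)^{-\kappa}=\bigcup_{q}(H)_{-q}^{-\kappa}$ with the locally convex inductive limit topology. The dual pairing of $(N)^{\kappa}$ and $(N)^{-\kappa}$ is $\langle\sum\varphi_nC_n,\Phi\rangle=\sum_n n!\,\varphi_n\Phi_n$. The $S$-transform of $\Phi\in(N)^{-\kappa}$ is $(S\Phi)(w)=\langle \mathrm e(w;\cdot),\Phi\rangle$; in the coordinate $z=e^w-1$ it reads $(\tilde S\Phi)(z)=\langle \mathrm e(\log(1+z);\cdot),\Phi\rangle$, $z\in\mathbb C$. For $k'=\frac{2}{1-\kappa}$ let $\mathcal E^{k'}_{\max}(\mathbb C)$ be the union over $l\in\mathbb N_0$ of the spaces of entire functions $U$ with $|U(z)|\le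 C\exp(2^l|z|^{k'})$ for some $C>0$, normed by $\sup_z|U(z)|\exp(-2^l|z|^{k'})$, with the locally convex inductive limit topology. **Theorem.** The transform $\Phi\mapsto\tilde S\Phi$ is a linear homeomorphism from $(N)^{-\kappa}$ onto $\mathcal E^{k'}_{\max}(\mathbb C)$, $k'=\frac2{1-\kappa}$, and $(S\Phi)(w)=(\tilde S\Phi)(e^w-1)$ for all $\Phi\in(N)^{-\kappa}$ and $w\in\mathbb C$. -/

import Mathlib

namespace FracPoisson

open scoped Nat Topology ENNReal
open MeasureTheory ProbabilityTheory Filter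

/-- The Mittag-Leffler function `E_β(z) = ∑ zⁿ / Γ(β n + 1)`. -/
noncomputable def mittagLeffler (β : ℝ) (z : ℂ) : ℂ :=
  ∑' n : ℕ, z ^ n / (Real.Gamma (β * n + 1) : ℂ)

lemma summable_mittagLeffler {β : ℝ} (hβ : 0 < β) {R : ℝ} (hR : 1 ≤ R) :
    Summable fun n : ℕ => R ^ n / Real.Gamma (β * n + 1) := by
  set K : ℝ := (2 * R) ^ (1 / β) with hK
  have h2R : (1 : ℝ) ≤ 2 * R := by linarith
  have hK1 : 1 ≤ K := Real.one_le_rpow h2R (by positivity)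
  have hlim := FloorSemiring.tendsto_pow_div_factorial_atTop K
  obtain ⟨B, hB⟩ := hlim.bddAbove_range
  have hfl : Tendsto (fun n : ℕ => ⌊β * n⌋₊) atTop atTop :=
    tendsto_nat_floor_atTop.comp
      (Tendsto.const_mul_atTop hβ tendsto_natCast_atTop_atTop)
  have hev : ∀ᶠ n : ℕ in atTop, 1 ≤ ⌊β * n⌋₊ := hfl.eventually_ge_atTop 1
  have hg : Summable fun n : ℕ => (K * B) * (1 / 2 : ℝ) ^ n :=
    (summable_geometric_of_lt_one (by norm_num) (by norm_num)).mul_left _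
  refine summable_of_isBigO_nat hg (Asymptotics.IsBigO.of_bound 1 ?_)
  filter_upwards [hev] with n hn
  set m := ⌊β * n⌋₊ with hm
  have hβn : 0 ≤ β * n := by positivity
  have h1 : (m : ℝ) ≤ β * n := Nat.floor_le hβn
  have h2 : β * n < m + 1 := Nat.lt_floor_add_one _
  have hm1 : (1 : ℝ) ≤ m := by exact_mod_cast hn
  have hG : (m ! : ℝ) ≤ Real.Gamma (β * n + 1) := by
    rw [← Real.Gamma_nat_eq_factorial]
    exact Real.Gamma_strictMonoOn_Ici.monotoneOn (by simp; linarith) (by simp; linarith)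
      (by linarith)
  have hmpos : (0 : ℝ) < m ! := by positivity
  have hGpos : 0 < Real.Gamma (β * n + 1) := hmpos.trans_le hG
  have hBm : K ^ m / m ! ≤ B := hB ⟨m, rfl⟩
  have hpow : (2 * R) ^ n ≤ K ^ m * K := by
    have : (2 * R) ^ n = K ^ (β * n) := by
      rw [hK, ← Real.rpow_mul (by linarith), ← Real.rpow_natCast]
      congr 1
      field_simp
    rw [this, ← pow_succ, ← Real.rpow_natCast K (m + 1)]
    exact Real.rpow_le_rpow_of_exponent_le hK1 (by push_cast; linarith)
  have hB0 : 0 ≤ B := le_trans (by positivity) hBm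
  rw [Real.norm_of_nonneg (by positivity), Real.norm_of_nonneg (by positivity), one_mul]
  calc R ^ n / Real.Gamma (β * n + 1) ≤ R ^ n / m ! := by gcongr
    _ = (2 * R) ^ n / m ! * (1 / 2) ^ n := by rw [mul_pow, one_div, inv_pow]; field_simp
    _ ≤ (K ^ m * K) / m ! * (1 / 2) ^ n := by gcongr
    _ = (K ^ m / m !) * K * (1 / 2) ^ n := by ring
    _ ≤ B * K * (1 / 2) ^ n := by gcongr
    _ = K * B * (1 / 2) ^ n := by ring

lemma differentiable_mittagLeffler {β : ℝ} (hβ : 0 < β) :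
    Differentiable ℂ (mittagLeffler β) := by
  intro z
  set R : ℝ := ‖z‖ + 1
  have hR : 1 ≤ R := by simp [R]
  have : DifferentiableOn ℂ (mittagLeffler β) (Metric.ball 0 R) := by
    refine Complex.differentiableOn_tsum_of_summable_norm (summable_mittagLeffler hβ hR)
      (fun n => by fun_prop) Metric.isOpen_ball ?_
    intro n w hw
    have hw : ‖w‖ ≤ R := by simpa using (mem_ball_zero_iff.1 hw).le
    have hG : 0 < Real.Gamma (β * n + 1) := Real.Gamma_pos_of_pos (by positivity)
    rw [norm_div, norm_pow, Complex.norm_real, Real.norm_of_nonneg hG.le]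
    gcongr
  exact this.differentiableAt (Metric.isOpen_ball.mem_nhds (by simp [R]))

lemma mittagLeffler_zero (β : ℝ) : mittagLeffler β 0 = 1 := by
  rw [mittagLeffler, tsum_eq_single 0 (fun n hn => by simp [hn])]
  simp

/-- The point mass `λᵏ / k! · E_β⁽ᵏ⁾(-λ)` of the fractional Poisson measure at `k`. The derivatives
of `E_β` at real points are real, so the real part only changes the type. -/
noncomputable def weight (lam β : ℝ) (k : ℕ) : ℝ :=
  lam ^ k / k ! * (iteratedDeriv k (mittagLeffler β) (-lam : ℂ)).re

/-- The fractional Poisson measure `π_{λ,β} = ∑ₖ λᵏ / k! · E_β⁽ᵏ⁾(-λ) δₖ` on `ℝ`. For `0 < β ≤ 1`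
and `λ > 0` the masses are nonnegative (complete monotonicity of `x ↦ E_β(-x)`), so
`ENNReal.ofReal` only changes the type. -/
noncomputable def measure (lam β : ℝ) : Measure ℝ :=
  Measure.sum fun k : ℕ => ENNReal.ofReal (weight lam β k) • Measure.dirac (k : ℝ)

lemma hasSum_weight {lam β : ℝ} (hβ : 0 < β) : HasSum (weight lam β) 1 := by
  have h := Complex.hasSum_taylorSeries_of_entire (differentiable_mittagLeffler hβ) (-lam : ℂ) 0
  rw [mittagLeffler_zero] at h
  have h' := Complex.hasSum_re h
  simp only [Complex.one_re] at h'
  convert h' using 2 with k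
  rw [weight]
  have : ((k ! : ℂ)⁻¹ • (0 - -(lam : ℂ)) ^ k • iteratedDeriv k (mittagLeffler β) (-lam : ℂ)) =
    ((lam ^ k / k ! : ℝ) : ℂ) * iteratedDeriv k (mittagLeffler β) (-lam : ℂ) := by
      push_cast; simp only [smul_eq_mul]; ring
  rw [this, Complex.re_ofReal_mul]

lemma summable_weight {lam β : ℝ} (hβ : 0 < β) (hlam : 0 < lam) {r : ℝ} (hr : 0 ≤ r) :
    Summable fun k => |weight lam β k| * r ^ k := by
  have h := (Complex.hasSum_taylorSeries_of_entire (differentiable_mittagLeffler hβ) (-lam : ℂ)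
    (-lam + lam * r)).summable.norm
  refine Summable.of_nonneg_of_le (fun k => by positivity) (fun k => ?_) h
  rw [add_sub_cancel_left, norm_smul, norm_smul, norm_inv, norm_pow, norm_mul, weight, abs_mul,
    abs_of_nonneg (by positivity : 0 ≤ lam ^ k / (k ! : ℝ))]
  simp only [RCLike.norm_natCast, Complex.norm_real, Real.norm_of_nonneg hlam.le,
    Real.norm_of_nonneg hr]
  calc _ ≤ lam ^ k / k ! * ‖iteratedDeriv k (mittagLeffler β) (-lam : ℂ)‖ * r ^ k := by
        gcongr; exact Complex.abs_re_le_norm _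
    _ = _ := by rw [mul_pow]; ring

lemma integrable_exp {lam β : ℝ} (hβ : 0 < β) (hlam : 0 < lam) (t : ℝ) :
    Integrable (fun x : ℝ => Real.exp (t * x)) (measure lam β) := by
  refine ⟨by fun_prop, ?_⟩
  rw [hasFiniteIntegral_iff_ofReal (by filter_upwards with x; positivity), measure,
    lintegral_sum_measure]
  simp only [lintegral_smul_measure, lintegral_dirac, smul_eq_mul]
  have h := summable_weight (β := β) (lam := lam) hβ hlam (Real.exp_pos t).le
  have h2 := h.tsum_ofReal_ne_top
  refine lt_of_le_of_lt (ENNReal.tsum_le_tsum fun k => ?_) h2.lt_top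
  rw [← ENNReal.ofReal_mul' (by positivity), mul_comm t, Real.exp_nat_mul]
  apply ENNReal.ofReal_le_ofReal
  gcongr
  exact le_abs_self _

lemma measure_ne_zero {lam β : ℝ} (hβ : 0 < β) : measure lam β ≠ 0 := by
  intro h0
  have hk : ∀ k, weight lam β k ≤ 0 := by
    intro k
    have := congrArg (fun μ : Measure ℝ => μ {(k : ℝ)}) h0
    simp only [measure, Measure.coe_zero, Pi.zero_apply] at this
    rw [Measure.sum_apply _ (measurableSet_singleton _), ENNReal.tsum_eq_zero] at this
    have := this k
    simpa using this
  have := hasSum_le hk (hasSum_weight (lam := lam) hβ) hasSum_zero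
  linarith


/-- The Laplace transform `l(z) = ∫ exp (z x) dπ_{λ,β}(x)`. -/
noncomputable def laplace (lam β : ℝ) (z : ℂ) : ℂ := complexMGF id (measure lam β) z

/-- The Wick exponential `e(z; x) = exp (z x) / l(z)`. -/
noncomputable def wickExp (lam β : ℝ) (z : ℂ) (x : ℝ) : ℂ :=
  Complex.exp (z * x) / laplace lam β z

/-- The generalized Appell polynomial `Cₙ`: the polynomial whose value at each real `x` is
`dⁿ/dzⁿ e(log (1 + z); x)` at `z = 0`. It exists and is unique, see `genAppell_eval`, `poly_ext`. -/
noncomputable def genAppell (lam β : ℝ) (n : ℕ) : Polynomial ℂ :=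
  Classical.epsilon fun p : Polynomial ℂ => ∀ x : ℝ,
    p.eval (x : ℂ) = iteratedDeriv n (fun z : ℂ => wickExp lam β (Complex.log (1 + z)) x) 0

lemma mem_interior_expSet {lam β : ℝ} (hβ : 0 < β) (hlam : 0 < lam) (t : ℝ) :
    t ∈ interior (integrableExpSet id (measure lam β)) := by
  have : integrableExpSet id (measure lam β) = Set.univ :=
    Set.eq_univ_of_forall fun t => integrable_exp hβ hlam t
  simp [this]

lemma isOpen_dom : IsOpen {z : ℂ | 1 + z ∈ Complex.slitPlane} :=
  Complex.isOpen_slitPlane.preimage (by fun_prop)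

lemma zero_mem_dom : (0 : ℂ) ∈ {z : ℂ | 1 + z ∈ Complex.slitPlane} := by simp

lemma hasDerivAt_log_one_add {z : ℂ} (hz : 1 + z ∈ Complex.slitPlane) :
    HasDerivAt (fun z : ℂ => Complex.log (1 + z)) (1 + z)⁻¹ z := by
  simpa using ((hasDerivAt_id z).const_add 1).clog hz

lemma inv_eq_exp {z : ℂ} (hz : 1 + z ∈ Complex.slitPlane) :
    (1 + z)⁻¹ = Complex.exp (-Complex.log (1 + z)) := by
  rw [Complex.exp_neg, Complex.exp_log (Complex.slitPlane_ne_zero hz)]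

lemma iteratedDeriv_pow (x : ℂ) (k : ℕ) : ∀ z : ℂ, 1 + z ∈ Complex.slitPlane →
    iteratedDeriv k (fun z : ℂ => Complex.exp (Complex.log (1 + z) * x)) z =
      (descPochhammer ℂ k).eval x * Complex.exp (Complex.log (1 + z) * (x - k)) := by
  induction k with
  | zero => intro z _; simp
  | succ k ih =>
    intro z hz
    rw [iteratedDeriv_succ, Filter.EventuallyEq.deriv_eq
      (Filter.eventually_of_mem (isOpen_dom.mem_nhds hz) ih)]
    have h := (((hasDerivAt_log_one_add hz).mul_const (x - k)).cexp).const_mul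
      ((descPochhammer ℂ k).eval x)
    rw [h.deriv, descPochhammer_succ_eval, inv_eq_exp hz]
    have : Complex.log (1 + z) * (x - ((k + 1 : ℕ) : ℂ)) =
      Complex.log (1 + z) * (x - k) + -Complex.log (1 + z) := by push_cast; ring
    rw [this, Complex.exp_add]
    ring

lemma integrable_poly {lam β : ℝ} (hβ : 0 < β) (hlam : 0 < lam) (p : Polynomial ℂ) (w : ℂ) :
    Integrable (fun x : ℝ => p.eval (x : ℂ) * Complex.exp (w * x)) (measure lam β) := by
  induction p using Polynomial.induction_on' with
  | add p q hp hq =>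
    refine (hp.add hq).congr (Eventually.of_forall fun x => ?_)
    simp [add_mul]
  | monomial n a =>
    have h := integrable_pow_mul_cexp_of_re_mem_interior_integrableExpSet
      (mem_interior_expSet hβ hlam w.re) n
    simpa [mul_assoc] using h.const_mul a

lemma hasDerivAt_integral_poly {lam β : ℝ} (hβ : 0 < β) (hlam : 0 < lam) (p : Polynomial ℂ)
    (w : ℂ) :
    HasDerivAt (fun w : ℂ => ∫ x : ℝ, p.eval (x : ℂ) * Complex.exp (w * x) ∂measure lam β)
      (∫ x : ℝ, (Polynomial.X * p).eval (x : ℂ) * Complex.exp (w * x) ∂measure lam β) w := by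
  induction p using Polynomial.induction_on' with
  | add p q hp hq =>
    convert! hp.add hq using 1
    · ext w
      rw [Pi.add_apply, ← integral_add (integrable_poly hβ hlam p w) (integrable_poly hβ hlam q w)]
      simp [add_mul]
    · rw [← integral_add (integrable_poly hβ hlam _ w) (integrable_poly hβ hlam _ w)]
      simp [add_mul, mul_add]
  | monomial n a =>
    have h := (hasDerivAt_integral_pow_mul_exp (mem_interior_expSet hβ hlam w.re) n).const_mul a
    convert! h using 1
    · ext w
      rw [← integral_const_mul]
      simp [mul_assoc]
    · rw [← integral_const_mul]
      simp [pow_succ, mul_left_comm, mul_comm]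

lemma iteratedDeriv_laplace {lam β : ℝ} (hβ : 0 < β) (hlam : 0 < lam) (k : ℕ) :
    ∀ z : ℂ, 1 + z ∈ Complex.slitPlane →
    iteratedDeriv k (fun z : ℂ => laplace lam β (Complex.log (1 + z))) z =
      Complex.exp (-k * Complex.log (1 + z)) * ∫ x : ℝ, (descPochhammer ℂ k).eval (x : ℂ) *
        Complex.exp (Complex.log (1 + z) * x) ∂measure lam β := by
  induction k with
  | zero => intro z _; simp [laplace, complexMGF]
  | succ k ih =>
    intro z hz
    rw [iteratedDeriv_succ, Filter.EventuallyEq.deriv_eq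
      (Filter.eventually_of_mem (isOpen_dom.mem_nhds hz) ih)]
    have h1 := ((hasDerivAt_log_one_add hz).const_mul (-k : ℂ)).cexp
    have h2 := (hasDerivAt_integral_poly hβ hlam (descPochhammer ℂ k)
      (Complex.log (1 + z))).comp z (hasDerivAt_log_one_add hz)
    have h := h1.mul h2
    have h' := h.deriv
    rw [Pi.mul_def] at h'
    simp only [Function.comp_def] at h'
    rw [h', inv_eq_exp hz]
    have e1 : Complex.exp (-((k + 1 : ℕ) : ℂ) * Complex.log (1 + z)) =
        Complex.exp (-k * Complex.log (1 + z)) * Complex.exp (-Complex.log (1 + z)) := by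
      rw [← Complex.exp_add]; push_cast; ring_nf
    have e2 : ∫ x : ℝ, (descPochhammer ℂ (k + 1)).eval (x : ℂ) *
        Complex.exp (Complex.log (1 + z) * x) ∂measure lam β =
        (∫ x : ℝ, (Polynomial.X * descPochhammer ℂ k).eval (x : ℂ) *
        Complex.exp (Complex.log (1 + z) * x) ∂measure lam β) - k *
        ∫ x : ℝ, (descPochhammer ℂ k).eval (x : ℂ) *
        Complex.exp (Complex.log (1 + z) * x) ∂measure lam β := by
      rw [← integral_const_mul, ← integral_sub (integrable_poly hβ hlam _ _)
        ((integrable_poly hβ hlam _ _).const_mul _)]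
      congr 1
      ext x
      rw [descPochhammer_succ_eval]
      simp
      ring
    rw [e1, e2]
    ring

lemma laplace_zero_ne {lam β : ℝ} (hβ : 0 < β) (hlam : 0 < lam) : laplace lam β 0 ≠ 0 := by
  have hi : Integrable (fun _ : ℝ => (1 : ℝ)) (measure lam β) := by
    simpa using integrable_exp hβ hlam 0
  have : IsFiniteMeasure (measure lam β) := by
    simpa [integrable_const_iff] using hi
  have h0 := measure_ne_zero (lam := lam) hβ
  simp [laplace, complexMGF, measureReal_eq_zero_iff, h0]

lemma analyticAt_laplace_log {lam β : ℝ} (hβ : 0 < β) (hlam : 0 < lam) :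
    AnalyticAt ℂ (fun z : ℂ => laplace lam β (Complex.log (1 + z))) 0 := by
  have h1 : AnalyticAt ℂ (laplace lam β) (Complex.log (1 + 0)) :=
    analyticAt_complexMGF (mem_interior_expSet hβ hlam _)
  have h2 : AnalyticAt ℂ (fun z : ℂ => Complex.log (1 + z)) 0 :=
    AnalyticAt.clog (by fun_prop) (by simp)
  exact AnalyticAt.fun_comp h1 h2

lemma analyticAt_inv_laplace {lam β : ℝ} (hβ : 0 < β) (hlam : 0 < lam) :
    AnalyticAt ℂ (fun z : ℂ => (laplace lam β (Complex.log (1 + z)))⁻¹) 0 :=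
  (analyticAt_laplace_log hβ hlam).inv (by simpa using laplace_zero_ne hβ hlam)

lemma analyticAt_pow (x : ℂ) :
    AnalyticAt ℂ (fun z : ℂ => Complex.exp (Complex.log (1 + z) * x)) 0 := by
  have h2 : AnalyticAt ℂ (fun z : ℂ => Complex.log (1 + z)) 0 :=
    AnalyticAt.clog (by fun_prop) (by simp)
  exact (h2.mul analyticAt_const).cexp

lemma analyticAt_wickExp {lam β : ℝ} (hβ : 0 < β) (hlam : 0 < lam) (x : ℝ) :
    AnalyticAt ℂ (fun z : ℂ => wickExp lam β (Complex.log (1 + z)) x) 0 := by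
  simp only [wickExp, div_eq_mul_inv]
  exact (analyticAt_pow x).fun_mul (analyticAt_inv_laplace hβ hlam)

/-- `Cₙ` in the basis of falling factorials. -/
noncomputable def explicitAppell (lam β : ℝ) (n : ℕ) : Polynomial ℂ :=
  ∑ k ∈ Finset.range (n + 1), Polynomial.C ((n.choose k : ℂ) * iteratedDeriv (n - k)
    (fun z : ℂ => (laplace lam β (Complex.log (1 + z)))⁻¹) 0) * descPochhammer ℂ k

lemma explicitAppell_eval {lam β : ℝ} (hβ : 0 < β) (hlam : 0 < lam) (n : ℕ) (x : ℝ) :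
    (explicitAppell lam β n).eval (x : ℂ) =
      iteratedDeriv n (fun z : ℂ => wickExp lam β (Complex.log (1 + z)) x) 0 := by
  simp only [wickExp, div_eq_mul_inv]
  rw [iteratedDeriv_fun_mul (analyticAt_pow x).contDiffAt
    (analyticAt_inv_laplace hβ hlam).contDiffAt, explicitAppell, Polynomial.eval_finsetSum]
  refine Finset.sum_congr rfl fun k _ => ?_
  rw [iteratedDeriv_pow x k 0 (by simp)]
  simp
  ring

theorem genAppell_eval {lam β : ℝ} (hlam : 0 < lam) (hβ : 0 < β) (n : ℕ) (x : ℝ) :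
    (genAppell lam β n).eval (x : ℂ) =
      iteratedDeriv n (fun z : ℂ => wickExp lam β (Complex.log (1 + z)) x) 0 :=
  Classical.epsilon_spec (p := fun p : Polynomial ℂ => ∀ x : ℝ,
    p.eval (x : ℂ) = iteratedDeriv n (fun z : ℂ => wickExp lam β (Complex.log (1 + z)) x) 0)
    ⟨_, explicitAppell_eval hβ hlam n⟩ x

lemma poly_ext {p q : Polynomial ℂ} (h : ∀ x : ℝ, p.eval (x : ℂ) = q.eval (x : ℂ)) : p = q := by
  refine Polynomial.eq_of_infinite_eval_eq p q (Set.Infinite.mono (s := Set.range ((↑) : ℝ → ℂ))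
    ?_ (Set.infinite_range_of_injective Complex.ofReal_injective))
  rintro _ ⟨x, rfl⟩
  exact h x

lemma genAppell_eq {lam β : ℝ} (hlam : 0 < lam) (hβ : 0 < β) (n : ℕ) :
    genAppell lam β n = explicitAppell lam β n :=
  poly_ext fun x => by rw [genAppell_eval hlam hβ, explicitAppell_eval hβ hlam]

/-- The generating function `e(log (1 + z); x) = ∑ zⁿ / n! · Cₙ(x)` for small `z`. -/
theorem hasSum_genAppell {lam β : ℝ} (hlam : 0 < lam) (hβ : 0 < β) (x : ℝ) :
    ∀ᶠ z : ℂ in 𝓝 0, HasSum (fun n : ℕ => z ^ n / n ! * (genAppell lam β n).eval (x : ℂ))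
      (wickExp lam β (Complex.log (1 + z)) x) := by
  have h := (analyticAt_wickExp hβ hlam x).hasFPowerSeriesAt.eventually_hasSum
  filter_upwards [h] with z hz
  rw [zero_add] at hz
  refine hz.congr_fun fun n => ?_
  rw [genAppell_eval hlam hβ, FormalMultilinearSeries.apply_eq_prod_smul_coeff]
  simp [FormalMultilinearSeries.coeff_ofScalars]
  ring

/-- The difference operator `(Δ f)(x) = f(x + 1) - f(x)` on polynomials. -/
noncomputable def diffOp : Polynomial ℂ →ₗ[ℂ] Polynomial ℂ :=
  Polynomial.taylor 1 - LinearMap.id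

lemma expect_genAppell {lam β : ℝ} (hlam : 0 < lam) (hβ : 0 < β) (n : ℕ) :
    ∫ x : ℝ, (genAppell lam β n).eval (x : ℂ) ∂measure lam β = if n = 0 then 1 else 0 := by
  have hne : ∀ᶠ z in 𝓝 (0 : ℂ), laplace lam β (Complex.log (1 + z)) ≠ 0 :=
    (analyticAt_laplace_log hβ hlam).continuousAt.eventually_ne
      (by simpa using laplace_zero_ne hβ hlam)
  have h1 : iteratedDeriv n (fun z : ℂ => laplace lam β (Complex.log (1 + z)) *
      (laplace lam β (Complex.log (1 + z)))⁻¹) 0 = if n = 0 then 1 else 0 := by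
    have : (fun z : ℂ => laplace lam β (Complex.log (1 + z)) *
      (laplace lam β (Complex.log (1 + z)))⁻¹) =ᶠ[𝓝 0] fun _ => (1 : ℂ) := by
      filter_upwards [hne] with z hz using mul_inv_cancel₀ hz
    rw [this.iteratedDeriv_eq, iteratedDeriv_const]
  rw [← h1, iteratedDeriv_fun_mul (analyticAt_laplace_log hβ hlam).contDiffAt
    (analyticAt_inv_laplace hβ hlam).contDiffAt, genAppell_eq hlam hβ, explicitAppell]
  have hint : ∀ k : ℕ, Integrable (fun x : ℝ => (descPochhammer ℂ k).eval (x : ℂ))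
      (measure lam β) := fun k => by
    simpa using integrable_poly hβ hlam (descPochhammer ℂ k) 0
  simp only [Polynomial.eval_finsetSum, Polynomial.eval_mul, Polynomial.eval_C]
  rw [integral_finsetSum _ fun k _ => (hint k).const_mul _]
  refine Finset.sum_congr rfl fun k _ => ?_
  rw [integral_const_mul, iteratedDeriv_laplace hβ hlam k 0 (by simp)]
  simp
  ring

lemma diffOp_genAppell {lam β : ℝ} (hlam : 0 < lam) (hβ : 0 < β) (n : ℕ) :
    diffOp (genAppell lam β (n + 1)) = ((n : ℂ) + 1) • genAppell lam β n := by
  have hd : ∀ k : ℕ, diffOp (descPochhammer ℂ (k + 1)) = ((k : ℂ) + 1) • descPochhammer ℂ k := by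
    intro k
    refine poly_ext fun x => ?_
    have : (descPochhammer ℂ (k + 1)).eval ((x : ℂ) + 1) =
        ((x : ℂ) + 1) * (descPochhammer ℂ k).eval (x : ℂ) := by
      rw [descPochhammer_succ_left]; simp
    simp only [diffOp, LinearMap.sub_apply, Polynomial.eval_sub, Polynomial.taylor_eval, this,
      LinearMap.id_apply, descPochhammer_succ_eval, Polynomial.eval_smul, smul_eq_mul]
    ring
  have h0 : diffOp (descPochhammer ℂ 0) = 0 := by simp [diffOp]
  rw [genAppell_eq hlam hβ, genAppell_eq hlam hβ, explicitAppell, explicitAppell, map_sum,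
    Finset.sum_range_succ', Finset.smul_sum]
  simp only [← Polynomial.smul_eq_C_mul, map_smul, h0, smul_zero, add_zero, hd, smul_smul]
  refine Finset.sum_congr rfl fun k _ => ?_
  congr 1
  rw [Nat.add_sub_add_right]
  have := Nat.add_one_mul_choose_eq n k
  have : ((n : ℂ) + 1) * n.choose k = (n + 1).choose (k + 1) * (k + 1) := by exact_mod_cast this
  linear_combination (-(iteratedDeriv (n - k)
    (fun z : ℂ => (laplace lam β (Complex.log (1 + z)))⁻¹) 0)) * this

lemma hasSum_wickExp {lam β : ℝ} (hlam : 0 < lam) (hβ : 0 < β) (x : ℝ) :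
    ∀ᶠ w : ℂ in 𝓝 0, HasSum
      (fun n : ℕ => (Complex.exp w - 1) ^ n / n ! * (genAppell lam β n).eval (x : ℂ))
      (wickExp lam β w x) := by
  have ht : Tendsto (fun w : ℂ => Complex.exp w - 1) (𝓝 0) (𝓝 0) := by
    have : Continuous fun w : ℂ => Complex.exp w - 1 := by fun_prop
    simpa using this.tendsto 0
  filter_upwards [ht.eventually (hasSum_genAppell hlam hβ x),
    Metric.ball_mem_nhds (0 : ℂ) Real.pi_pos] with w hw hw'
  have hpi : |w.im| < Real.pi := (Complex.abs_im_le_norm w).trans_lt (by simpa using hw')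
  rwa [add_sub_cancel, Complex.log_exp (abs_lt.1 hpi).1 (abs_lt.1 hpi).2.le] at hw

/-- The dual Appell system `Q_k = (Δᵏ)* 1`, where `1` acts on polynomials by integration:
`⟨f, Q_k⟩ = ∫ (Δᵏ f)(x) dπ_{λ,β}(x)`. -/
noncomputable def dualAppell (lam β : ℝ) (k : ℕ) (f : Polynomial ℂ) : ℂ :=
  ∫ x : ℝ, ((diffOp ^ k) f).eval (x : ℂ) ∂measure lam β

lemma dualAppell_add {lam β : ℝ} (hlam : 0 < lam) (hβ : 0 < β) (k : ℕ) (f ψ : Polynomial ℂ) :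
    dualAppell lam β k (f + ψ) = dualAppell lam β k f + dualAppell lam β k ψ := by
  have h : ∀ p : Polynomial ℂ, Integrable (fun x : ℝ => p.eval (x : ℂ)) (measure lam β) :=
    fun p => by simpa using integrable_poly hβ hlam p 0
  simp only [dualAppell, map_add, Polynomial.eval_add]
  exact integral_add (h _) (h _)

lemma dualAppell_smul {lam β : ℝ} (k : ℕ) (c : ℂ) (f : Polynomial ℂ) :
    dualAppell lam β k (c • f) = c * dualAppell lam β k f := by
  simp only [dualAppell, map_smul, Polynomial.eval_smul, smul_eq_mul]
  exact integral_const_mul _ _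

/-- Biorthogonality `⟨Cₙ, Q_k⟩ = n! δ_{n,k}`. -/
theorem dualAppell_genAppell {lam β : ℝ} (hlam : 0 < lam) (hβ : 0 < β) (n k : ℕ) :
    dualAppell lam β k (genAppell lam β n) = if k = n then (n ! : ℂ) else 0 := by
  induction k generalizing n with
  | zero =>
    have := expect_genAppell hlam hβ n
    rw [dualAppell, pow_zero, Module.End.one_apply, this]
    rcases n with _ | n <;> simp
  | succ k ih =>
    rcases n with _ | n
    · have h0 : diffOp (genAppell lam β 0) = 0 := by
        simp [genAppell_eq hlam hβ, explicitAppell, diffOp]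
      rw [dualAppell, pow_succ, Module.End.mul_apply, h0]
      simp
    · have h1 : dualAppell lam β (k + 1) (genAppell lam β (n + 1)) =
          dualAppell lam β k (((n : ℂ) + 1) • genAppell lam β n) := by
        rw [dualAppell, pow_succ, Module.End.mul_apply, diffOp_genAppell hlam hβ, dualAppell]
      rw [h1, dualAppell_smul, ih]
      by_cases h : k = n
      · simp [h, Nat.factorial_succ]
      · simp [h]

lemma degree_genAppell {lam β : ℝ} (hlam : 0 < lam) (hβ : 0 < β) (n : ℕ) :
    (genAppell lam β n).degree = n := by
  have hd : ∀ k : ℕ, (descPochhammer ℂ k).degree = k := fun k => by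
    rw [Polynomial.degree_eq_natDegree (monic_descPochhammer ℂ k).ne_zero,
      descPochhammer_natDegree]
  have hne := laplace_zero_ne (lam := lam) hβ hlam
  rw [genAppell_eq hlam hβ, explicitAppell, Finset.sum_range_succ]
  have htop : (Polynomial.C (((n.choose n : ℕ) : ℂ) * iteratedDeriv (n - n)
      (fun z : ℂ => (laplace lam β (Complex.log (1 + z)))⁻¹) 0) * descPochhammer ℂ n).degree =
      n := by
    rw [Polynomial.degree_C_mul (by simpa using hne), hd]
  rw [Polynomial.degree_add_eq_right_of_degree_lt, htop]
  rw [htop]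
  refine (Polynomial.degree_sum_le _ _).trans_lt ((Finset.sup_lt_iff (WithBot.bot_lt_coe n)).2
    fun k hk => ?_)
  refine lt_of_le_of_lt (b := (descPochhammer ℂ k).degree) ?_ ?_
  · rw [← Polynomial.smul_eq_C_mul]
    exact Polynomial.degree_smul_le _ _
  · rw [hd]
    exact Nat.cast_lt.2 (Finset.mem_range.1 hk)

theorem span_genAppell {lam β : ℝ} (hlam : 0 < lam) (hβ : 0 < β) :
    Submodule.span ℂ (Set.range (genAppell lam β)) = ⊤ :=
  Polynomial.Sequence.span (⟨genAppell lam β, degree_genAppell hlam hβ⟩ : Polynomial.Sequence ℂ)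
    fun i => (Polynomial.leadingCoeff_ne_zero.2 (Polynomial.Sequence.ne_zero _ i)).isUnit

/-- The coefficient `Φₙ = ⟨Cₙ, Φ⟩ / n!` of a generalized function `Φ`. A generalized function is a
linear functional on the polynomials; every linear functional is continuous for convergence of the
coefficients with bounded degree. -/
noncomputable def coeff (lam β : ℝ) (Φ : Module.Dual ℂ (Polynomial ℂ)) (n : ℕ) : ℂ :=
  Φ (genAppell lam β n) / n !

/-- `Φ = ∑ aₖ Q_k` holds, in the sense of functionals on polynomials, exactly for `aₖ = Φₖ`. -/
theorem hasSum_dualAppell_iff {lam β : ℝ} (hlam : 0 < lam) (hβ : 0 < β)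
    (Φ : Module.Dual ℂ (Polynomial ℂ)) (a : ℕ → ℂ) :
    (∀ f : Polynomial ℂ, HasSum (fun k => a k * dualAppell lam β k f) (Φ f)) ↔
      a = coeff lam β Φ := by
  have hs : ∀ (a : ℕ → ℂ) (n : ℕ),
      HasSum (fun k => a k * dualAppell lam β k (genAppell lam β n)) (a n * n !) := by
    intro a n
    convert! hasSum_single (f := fun k => a k * dualAppell lam β k (genAppell lam β n)) n ?_
      using 1
    · simp [dualAppell_genAppell hlam hβ]
    · intro k hk
      simp [dualAppell_genAppell hlam hβ, hk]
  have hfac : ∀ n : ℕ, (n ! : ℂ) ≠ 0 := fun n => by exact_mod_cast n.factorial_ne_zero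
  constructor
  · intro h
    ext n
    rw [coeff, eq_div_iff (hfac n)]
    exact (hs a n).unique (h _)
  · rintro rfl f
    have hf : f ∈ Submodule.span ℂ (Set.range (genAppell lam β)) := by
      rw [span_genAppell hlam hβ]; trivial
    induction hf using Submodule.span_induction with
    | mem p hp =>
      obtain ⟨n, rfl⟩ := hp
      have := hs (coeff lam β Φ) n
      rwa [coeff, div_mul_cancel₀ _ (hfac n)] at this
    | zero =>
      convert! (hasSum_zero : HasSum (fun _ : ℕ => (0 : ℂ)) 0) using 1
      · ext k
        simp [dualAppell]
      · simp
    | add p q _ _ hp hq =>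
      rw [map_add]
      convert! hp.add hq using 1
      ext k
      rw [dualAppell_add hlam hβ, mul_add]
    | smul c p _ hp =>
      rw [map_smul, smul_eq_mul]
      convert! hp.mul_left c using 1
      ext k
      rw [dualAppell_smul]
      ring

lemma coeff_add (lam β : ℝ) (Φ Ψ : Module.Dual ℂ (Polynomial ℂ)) (n : ℕ) :
    coeff lam β (Φ + Ψ) n = coeff lam β Φ n + coeff lam β Ψ n := by
  simp [coeff, add_div]

lemma coeff_smul (lam β : ℝ) (c : ℂ) (Φ : Module.Dual ℂ (Polynomial ℂ)) (n : ℕ) :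
    coeff lam β (c • Φ) n = c * coeff lam β Φ n := by
  simp [coeff, mul_div_assoc]

/-- The weight `(n!)^{1-κ} 2^{-nq}`. -/
noncomputable def wt (κ : ℝ) (q n : ℕ) : ℝ := (n ! : ℝ) ^ (1 - κ) * ((2 : ℝ) ^ (n * q))⁻¹

lemma wt_nonneg (κ : ℝ) (q n : ℕ) : 0 ≤ wt κ q n := by unfold wt; positivity

lemma wt_anti (κ : ℝ) (n : ℕ) {q r : ℕ} (h : q ≤ r) : wt κ r n ≤ wt κ q n := by
  unfold wt
  gcongr
  norm_num

/-- The space `(H)_{-q}^{-κ}` of all `Φ = ∑ Φₙ Qₙ` with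
`‖Φ‖² = ∑ (n!)^{1-κ} 2^{-nq} |Φₙ|² < ∞`. -/
noncomputable def hSubmodule (lam β κ : ℝ) (q : ℕ) :
    Submodule ℂ (Module.Dual ℂ (Polynomial ℂ)) where
  carrier := {Φ | Summable fun n => wt κ q n * ‖coeff lam β Φ n‖ ^ 2}
  zero_mem' := by simp [coeff, summable_zero]
  add_mem' := by
    intro Φ Ψ hΦ hΨ
    refine Summable.of_nonneg_of_le (fun n => mul_nonneg (wt_nonneg κ q n) (by positivity))
      (fun n => ?_) ((hΦ.add hΨ).mul_left 2)
    rw [coeff_add, ← mul_add, mul_left_comm]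
    refine mul_le_mul_of_nonneg_left ?_ (wt_nonneg κ q n)
    calc _ ≤ (‖coeff lam β Φ n‖ + ‖coeff lam β Ψ n‖) ^ 2 := by gcongr; exact norm_add_le _ _
      _ ≤ _ := add_sq_le
  smul_mem' := by
    intro c Φ hΦ
    refine (hΦ.mul_left (‖c‖ ^ 2)).congr fun n => ?_
    rw [coeff_smul, norm_mul]
    ring

/-- `(H)_{-q}^{-κ}` as a type of its own. -/
def HSpace (lam β κ : ℝ) (q : ℕ) : Type := hSubmodule lam β κ q

noncomputable instance (lam β κ : ℝ) (q : ℕ) : AddCommGroup (HSpace lam β κ q) :=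
  inferInstanceAs (AddCommGroup (hSubmodule lam β κ q))

noncomputable instance (lam β κ : ℝ) (q : ℕ) : Module ℂ (HSpace lam β κ q) :=
  inferInstanceAs (Module ℂ (hSubmodule lam β κ q))

lemma memlp_coeff {lam β κ : ℝ} {q : ℕ} (Φ : HSpace lam β κ q) :
    Memℓp (fun n : ℕ => (√(wt κ q n) : ℂ) * coeff lam β Φ.1 n) 2 := by
  refine memℓp_gen (Φ.2.congr fun n => ?_)
  simp [mul_pow, Real.sq_sqrt (wt_nonneg κ q n)]

/-- `Φ ↦ (((n!)^{1-κ} 2^{-nq})^{1/2} Φₙ)ₙ`, from `(H)_{-q}^{-κ}` to `ℓ²`. -/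
noncomputable def HSpace.toLp (lam β κ : ℝ) (q : ℕ) :
    HSpace lam β κ q →ₗ[ℂ] lp (fun _ : ℕ => ℂ) 2 where
  toFun Φ := ⟨fun n => (√(wt κ q n) : ℂ) * coeff lam β Φ.1 n, memlp_coeff Φ⟩
  map_add' Φ Ψ := lp.ext (funext fun n => by
    change (√(wt κ q n) : ℂ) * coeff lam β (Φ.1 + Ψ.1) n =
      (√(wt κ q n) : ℂ) * coeff lam β Φ.1 n + (√(wt κ q n) : ℂ) * coeff lam β Ψ.1 n
    rw [coeff_add, mul_add])
  map_smul' c Φ := lp.ext (funext fun n => by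
    change (√(wt κ q n) : ℂ) * coeff lam β (c • Φ.1) n =
      c * ((√(wt κ q n) : ℂ) * coeff lam β Φ.1 n)
    rw [coeff_smul, mul_left_comm])

/-- The norm of `(H)_{-q}^{-κ}`, see `HSpace.norm_sq`. -/
noncomputable instance (lam β κ : ℝ) (q : ℕ) : SeminormedAddCommGroup (HSpace lam β κ q) :=
  SeminormedAddCommGroup.induced _ _ (HSpace.toLp lam β κ q)

theorem HSpace.norm_sq {lam β κ : ℝ} {q : ℕ} (Φ : HSpace lam β κ q) :
    ‖Φ‖ ^ 2 = ∑' n : ℕ, wt κ q n * ‖coeff lam β Φ.1 n‖ ^ 2 := by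
  have h := lp.norm_rpow_eq_tsum (p := 2) (by norm_num) (HSpace.toLp lam β κ q Φ)
  have h2 : ‖HSpace.toLp lam β κ q Φ‖ ^ 2 =
      ∑' n : ℕ, ‖(√(wt κ q n) : ℂ) * coeff lam β Φ.1 n‖ ^ 2 := by
    simpa [HSpace.toLp] using h
  change ‖HSpace.toLp lam β κ q Φ‖ ^ 2 = _
  rw [h2]
  congr 1
  ext n
  simp [mul_pow, Real.sq_sqrt (wt_nonneg κ q n)]

lemma hSubmodule_mono (lam β κ : ℝ) {q r : ℕ} (h : q ≤ r) :
    hSubmodule lam β κ q ≤ hSubmodule lam β κ r := fun _ hΦ =>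
  Summable.of_nonneg_of_le (fun n => mul_nonneg (wt_nonneg κ r n) (by positivity))
    (fun n => mul_le_mul_of_nonneg_right (wt_anti κ n h) (by positivity)) hΦ

/-- The locally convex inductive limit topology: the finest locally convex vector space topology
on `E` for which all the maps `j i : F i → E` are continuous. -/
@[reducible] def lcLimitTopology {ι : Type*} {F : ι → Type*} [∀ i, TopologicalSpace (F i)]
    {E : Type*} [AddCommGroup E] [Module ℂ E] (j : ∀ i, F i → E) : TopologicalSpace E :=
  sInf {t : TopologicalSpace E | @IsTopologicalAddGroup E t _ ∧ @ContinuousSMul ℂ E _ _ t ∧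
    @LocallyConvexSpace ℝ E _ _ _ _ t ∧ ∀ i, @Continuous (F i) E _ t (j i)}

/-- The space `(N)^{-κ} = ⋃_q (H)_{-q}^{-κ}` of generalized functions. -/
noncomputable def nSubmodule (lam β κ : ℝ) : Submodule ℂ (Module.Dual ℂ (Polynomial ℂ)) where
  carrier := {Φ | ∃ q : ℕ, Φ ∈ hSubmodule lam β κ q}
  zero_mem' := ⟨0, zero_mem _⟩
  add_mem' := by
    rintro Φ Ψ ⟨q, hq⟩ ⟨r, hr⟩
    exact ⟨max q r, add_mem (hSubmodule_mono lam β κ (le_max_left q r) hq)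
      (hSubmodule_mono lam β κ (le_max_right q r) hr)⟩
  smul_mem' := by
    rintro c Φ ⟨q, hq⟩
    exact ⟨q, Submodule.smul_mem _ c hq⟩

/-- `(N)^{-κ}` as a type of its own. -/
def GenFun (lam β κ : ℝ) : Type := nSubmodule lam β κ

noncomputable instance (lam β κ : ℝ) : AddCommGroup (GenFun lam β κ) :=
  inferInstanceAs (AddCommGroup (nSubmodule lam β κ))

noncomputable instance (lam β κ : ℝ) : Module ℂ (GenFun lam β κ) :=
  inferInstanceAs (Module ℂ (nSubmodule lam β κ))

/-- The inclusion of `(H)_{-q}^{-κ}` into `(N)^{-κ}`. -/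
def HSpace.incl (lam β κ : ℝ) (q : ℕ) (Φ : HSpace lam β κ q) : GenFun lam β κ := ⟨Φ.1, q, Φ.2⟩

/-- `(N)^{-κ}` carries the inductive limit topology of the Hilbert spaces `(H)_{-q}^{-κ}`. -/
noncomputable instance (lam β κ : ℝ) : TopologicalSpace (GenFun lam β κ) :=
  lcLimitTopology (HSpace.incl lam β κ)

/-- The test function space `(N)^κ = ⋂_q (H)_q^κ`, where `∑ fₙ Cₙ` is given by the sequence of its
coefficients and `‖f‖²_{q,κ} = ∑ (n!)^{1+κ} 2^{nq} |fₙ|²`. -/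
def testSpace (κ : ℝ) : Set (ℕ → ℂ) :=
  {f | ∀ q : ℕ, Summable fun n => (n ! : ℝ) ^ (1 + κ) * (2 : ℝ) ^ (n * q) * ‖f n‖ ^ 2}

/-- The dual pairing `⟨f, Φ⟩ = ∑ n! fₙ Φₙ` of `f = ∑ fₙ Cₙ` and `Φ = ∑ Φₙ Qₙ`. It extends the
evaluation of `Φ` at polynomials, see `pairing_polynomial`, and converges for all `f ∈ (N)^κ` and
`Φ ∈ (N)^{-κ}`, see `summable_pairing`. -/
noncomputable def pairing (lam β : ℝ) (f : ℕ → ℂ) (Φ : Module.Dual ℂ (Polynomial ℂ)) : ℂ :=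
  ∑' n : ℕ, (n ! : ℂ) * f n * coeff lam β Φ n

lemma pairing_polynomial (lam β : ℝ) (c : ℕ →₀ ℂ) (Φ : Module.Dual ℂ (Polynomial ℂ)) :
    pairing lam β c Φ = Φ (c.sum fun n a => a • genAppell lam β n) := by
  rw [pairing, tsum_eq_sum (s := c.support) (fun n hn => by
    simp [Finsupp.notMem_support_iff.1 hn]), Finsupp.sum, map_sum]
  refine Finset.sum_congr rfl fun n _ => ?_
  have : (n ! : ℂ) ≠ 0 := by exact_mod_cast n.factorial_ne_zero
  rw [map_smul, coeff, smul_eq_mul]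
  field_simp

lemma summable_pairing {lam β κ : ℝ} {f : ℕ → ℂ} (hf : f ∈ testSpace κ) (Φ : GenFun lam β κ) :
    Summable fun n : ℕ => (n ! : ℂ) * f n * coeff lam β Φ.1 n := by
  obtain ⟨q, hq⟩ := Φ.2
  refine Summable.of_norm_bounded ((hf q).add hq) fun n => ?_
  have hn : (0 : ℝ) < n ! := by positivity
  have h1 : ((n ! : ℝ) ^ (1 + κ) * (2 : ℝ) ^ (n * q)) * wt κ q n = (n ! : ℝ) ^ 2 := by
    have : (n ! : ℝ) ^ (1 + κ) * (n ! : ℝ) ^ (1 - κ) = (n ! : ℝ) ^ 2 := by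
      rw [← Real.rpow_add hn, ← Real.rpow_natCast]; congr 1; push_cast; ring
    rw [wt, ← this]
    field_simp
  set A := (n ! : ℝ) ^ (1 + κ) * (2 : ℝ) ^ (n * q)
  have hA : 0 ≤ A := by positivity
  have hB := wt_nonneg κ q n
  set B := wt κ q n
  set a := ‖f n‖
  set b := ‖coeff lam β Φ.1 n‖
  have h2 : ‖(n ! : ℂ) * f n * coeff lam β Φ.1 n‖ = (√A * a) * (√B * b) := by
    have : √A * √B = n ! := by rw [← Real.sqrt_mul hA, h1, Real.sqrt_sq hn.le]
    simp only [norm_mul, RCLike.norm_natCast]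
    rw [← this]
    ring
  have ha : A * a ^ 2 = (√A * a) ^ 2 := by rw [mul_pow, Real.sq_sqrt hA]
  have hb : B * b ^ 2 = (√B * b) ^ 2 := by rw [mul_pow, Real.sq_sqrt hB]
  have hab := two_mul_le_add_sq (√A * a) (√B * b)
  have : 0 ≤ (√A * a) * (√B * b) := by positivity
  rw [h2]
  linarith

/-- The coefficients `zⁿ / n!` of the expansion `e(log (1 + z); ·) = ∑ zⁿ / n! · Cₙ`. -/
noncomputable def wickCoeff (z : ℂ) (n : ℕ) : ℂ := z ^ n / n !

/-- For `κ < 1` the series `∑ zⁿ / n! · Cₙ` defines an element of `(N)^κ` for every `z`. -/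
lemma wickCoeff_mem {κ : ℝ} (hκ : κ < 1) (z : ℂ) : wickCoeff z ∈ testSpace κ := by
  intro q
  have hlim := FloorSemiring.tendsto_pow_div_factorial_atTop
    ((2 * (2 : ℝ) ^ q * (‖z‖ ^ 2 + 1)) ^ (1 / (1 - κ)))
  obtain ⟨B, hB⟩ := hlim.bddAbove_range
  have hκ' : 0 < 1 - κ := by linarith
  refine Summable.of_nonneg_of_le (fun n => by positivity) (fun n => ?_)
    ((summable_geometric_of_lt_one (r := (1 / 2 : ℝ)) (by norm_num) (by norm_num)).mul_left
      (B ^ (1 - κ)))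
  have hn : (0 : ℝ) < n ! := by positivity
  set c : ℝ := 2 * (2 : ℝ) ^ q * (‖z‖ ^ 2 + 1) with hc
  have hcpos : 0 < c := by positivity
  have h1 : (c ^ (1 / (1 - κ))) ^ n / n ! ≤ B := hB ⟨n, rfl⟩
  have h2 : c ^ n / (n ! : ℝ) ^ (1 - κ) ≤ B ^ (1 - κ) := by
    have := Real.rpow_le_rpow (by positivity) h1 hκ'.le
    rwa [Real.div_rpow (by positivity) hn.le, ← Real.rpow_natCast, ← Real.rpow_mul hcpos.le,
      ← Real.rpow_mul hcpos.le, show 1 / (1 - κ) * n * (1 - κ) = n by field_simp,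
      Real.rpow_natCast] at this
  have h3 : (n ! : ℝ) ^ (1 + κ) = (n ! : ℝ) ^ 2 / (n ! : ℝ) ^ (1 - κ) := by
    rw [← Real.rpow_natCast, ← Real.rpow_sub hn]; congr 1; push_cast; ring
  calc (n ! : ℝ) ^ (1 + κ) * (2 : ℝ) ^ (n * q) * ‖wickCoeff z n‖ ^ 2
      = ((2 : ℝ) ^ q * ‖z‖ ^ 2) ^ n / (n ! : ℝ) ^ (1 - κ) := by
        rw [h3, wickCoeff, norm_div, norm_pow, RCLike.norm_natCast, mul_pow, ← pow_mul,
          ← pow_mul, mul_comm n q, mul_comm 2 n, pow_mul ‖z‖ n 2]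
        field_simp
    _ ≤ (c * (1 / 2)) ^ n / (n ! : ℝ) ^ (1 - κ) := by
        have : (0 : ℝ) < 2 ^ q := by positivity
        have hle : (2 : ℝ) ^ q * ‖z‖ ^ 2 ≤ c * (1 / 2) := by rw [hc]; nlinarith
        exact div_le_div_of_nonneg_right (pow_le_pow_left₀ (by positivity) hle n) (by positivity)
    _ = c ^ n / (n ! : ℝ) ^ (1 - κ) * (1 / 2) ^ n := by rw [mul_pow]; ring
    _ ≤ _ := by gcongr

/-- The `S`-transform in the coordinate `z = exp w - 1`: the pairing of `Φ` with
`e(log (1 + z); ·) = ∑ zⁿ / n! · Cₙ`. -/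
noncomputable def sTransformLog (lam β : ℝ) (Φ : Module.Dual ℂ (Polynomial ℂ)) (z : ℂ) : ℂ :=
  pairing lam β (wickCoeff z) Φ

/-- The `S`-transform in the original coordinate: the pairing of `Φ` with
`e(w; ·) = ∑ (exp w - 1)ⁿ / n! · Cₙ`. -/
noncomputable def sTransform (lam β : ℝ) (Φ : Module.Dual ℂ (Polynomial ℂ)) (w : ℂ) : ℂ :=
  pairing lam β (wickCoeff (Complex.exp w - 1)) Φ

/-- The space of entire functions `U` with `|U(z)| ≤ C exp (2^l |z|^k)` for some `C > 0`. -/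
def eSubmodule (k : ℝ) (l : ℕ) : Submodule ℂ (ℂ → ℂ) where
  carrier := {U | Differentiable ℂ U ∧
    ∃ C : ℝ, 0 < C ∧ ∀ z : ℂ, ‖U z‖ ≤ C * Real.exp ((2 : ℝ) ^ l * ‖z‖ ^ k)}
  zero_mem' := ⟨differentiable_const 0, 1, one_pos, fun z => by simp; positivity⟩
  add_mem' := by
    rintro U V ⟨hU, C, hC, h⟩ ⟨hV, D, hD, h'⟩
    refine ⟨hU.add hV, C + D, by positivity, fun z => ?_⟩
    rw [add_mul]
    exact (norm_add_le _ _).trans (add_le_add (h z) (h' z))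
  smul_mem' := by
    rintro c U ⟨hU, C, hC, h⟩
    refine ⟨hU.const_smul c, (‖c‖ + 1) * C, by positivity, fun z => ?_⟩
    rw [Pi.smul_apply, norm_smul, mul_assoc]
    exact mul_le_mul (by linarith) (h z) (norm_nonneg _) (by positivity)

/-- The space of the previous definition as a type of its own. -/
def ESpace (k : ℝ) (l : ℕ) : Type := eSubmodule k l

noncomputable instance (k : ℝ) (l : ℕ) : AddCommGroup (ESpace k l) :=
  inferInstanceAs (AddCommGroup (eSubmodule k l))

noncomputable instance (k : ℝ) (l : ℕ) : Module ℂ (ESpace k l) :=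
  inferInstanceAs (Module ℂ (eSubmodule k l))

lemma memlp_growth {k : ℝ} {l : ℕ} (U : ESpace k l) :
    Memℓp (fun z : ℂ => U.1 z * (Real.exp (-((2 : ℝ) ^ l * ‖z‖ ^ k)) : ℂ)) ∞ := by
  obtain ⟨C, _, h⟩ := U.2.2
  refine memℓp_infty ⟨C, ?_⟩
  rintro _ ⟨z, rfl⟩
  dsimp only
  rw [norm_mul, Complex.norm_real, Real.norm_of_nonneg (Real.exp_pos _).le, Real.exp_neg,
    ← div_eq_mul_inv, div_le_iff₀ (Real.exp_pos _)]
  exact h z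

/-- `U ↦ (U(z) exp (-2^l |z|^k))_z`, a linear map to the bounded functions on `ℂ`. -/
noncomputable def ESpace.toLp (k : ℝ) (l : ℕ) :
    ESpace k l →ₗ[ℂ] lp (fun _ : ℂ => ℂ) ∞ where
  toFun U := ⟨fun z => U.1 z * (Real.exp (-((2 : ℝ) ^ l * ‖z‖ ^ k)) : ℂ), memlp_growth U⟩
  map_add' U V := lp.ext (funext fun z => add_mul (U.1 z) (V.1 z) _)
  map_smul' c U := lp.ext (funext fun z => mul_assoc c (U.1 z) _)

/-- The norm `|U|_{l,k} = sup_z |U(z)| exp (-2^l |z|^k)`, see `ESpace.norm_eq`. -/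
noncomputable instance (k : ℝ) (l : ℕ) : SeminormedAddCommGroup (ESpace k l) :=
  SeminormedAddCommGroup.induced _ _ (ESpace.toLp k l)

theorem ESpace.norm_eq {k : ℝ} {l : ℕ} (U : ESpace k l) :
    ‖U‖ = ⨆ z : ℂ, ‖U.1 z‖ * Real.exp (-((2 : ℝ) ^ l * ‖z‖ ^ k)) := by
  change ‖ESpace.toLp k l U‖ = _
  rw [lp.norm_eq_ciSup]
  congr 1
  ext z
  change ‖U.1 z * (Real.exp (-((2 : ℝ) ^ l * ‖z‖ ^ k)) : ℂ)‖ = _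
  rw [norm_mul, Complex.norm_real, Real.norm_of_nonneg (Real.exp_pos _).le]

lemma eSubmodule_mono (k : ℝ) {l m : ℕ} (h : l ≤ m) : eSubmodule k l ≤ eSubmodule k m := by
  rintro U ⟨hU, C, hC, hb⟩
  refine ⟨hU, C, hC, fun z => (hb z).trans ?_⟩
  gcongr
  norm_num

/-- The space `ℰ^k_max(ℂ)` of entire functions of maximal type and order of growth `k`. -/
def eMaxSubmodule (k : ℝ) : Submodule ℂ (ℂ → ℂ) where
  carrier := {U | ∃ l : ℕ, U ∈ eSubmodule k l}
  zero_mem' := ⟨0, zero_mem _⟩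
  add_mem' := by
    rintro U V ⟨l, hl⟩ ⟨m, hm⟩
    exact ⟨max l m, add_mem (eSubmodule_mono k (le_max_left l m) hl)
      (eSubmodule_mono k (le_max_right l m) hm)⟩
  smul_mem' := by
    rintro c U ⟨l, hl⟩
    exact ⟨l, Submodule.smul_mem _ c hl⟩

/-- `ℰ^k_max(ℂ)` as a type of its own. -/
def EMax (k : ℝ) : Type := eMaxSubmodule k

noncomputable instance (k : ℝ) : AddCommGroup (EMax k) :=
  inferInstanceAs (AddCommGroup (eMaxSubmodule k))

noncomputable instance (k : ℝ) : Module ℂ (EMax k) :=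
  inferInstanceAs (Module ℂ (eMaxSubmodule k))

/-- The inclusion of the functions of type `2^l` into `ℰ^k_max(ℂ)`. -/
def ESpace.incl (k : ℝ) (l : ℕ) (U : ESpace k l) : EMax k := ⟨U.1, l, U.2⟩

/-- `ℰ^k_max(ℂ)` carries the inductive limit topology of its subspaces of type `2^l`. -/
noncomputable instance (k : ℝ) : TopologicalSpace (EMax k) := lcLimitTopology (ESpace.incl k)

end FracPoisson

namespace FracPoisson

open scoped Nat Topology ENNReal
open MeasureTheory ProbabilityTheory Filter

/-! In the coordinate `z`, the factor `n!` of the pairing cancels the `1 / n!` of the Wick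
exponential, so the transform of `Φ` is the power series `∑ Φₙ zⁿ` (`hasSum_sTransformLog`): the
`Φₙ` are its Taylor coefficients. The measure matters only through `deg Cₙ = n`, which makes the
`Cₙ` a basis, so that every sequence is the coefficient sequence of exactly one functional
(`coeff_injective`, `coeff_surjective`).

What remains is a fact about entire functions: growth of order `2 / (1 - κ)` and finite type is
equivalent to square summability of the Taylor coefficients against `(n!)^{1-κ} 2^{-nq}` for some
`q`. From coefficients to growth, `exists_pow_le_sqrt_wt_mul_exp` bounds each monomial by the root
of the weight times one fixed exponential, with a summable factor to spare. From growth to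
coefficients, `exists_wt_mul_norm_taylorCoeff_sq_le` applies Cauchy's estimate on a nearly optimal
circle.

In both estimates the target step depends only on the source step, and the bound is linear in the
norm. Hence the transform and its inverse map steps boundedly into steps, and
`continuous_lcLimitTopology` turns this into continuity for the limit topologies. -/

/-! ### Linear maps between inductive limits -/

/-- A linear map between locally convex inductive limits is continuous if it maps every step
continuously into some step. -/
lemma continuous_lcLimitTopology {ι ι' : Type*} {F : ι → Type*} [∀ i, TopologicalSpace (F i)]
    {F' : ι' → Type*} [∀ i, TopologicalSpace (F' i)] {E E' : Type*} [AddCommGroup E] [Module ℂ E]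
    [AddCommGroup E'] [Module ℂ E'] (j : ∀ i, F i → E) (j' : ∀ i, F' i → E') (f : E →ₗ[ℂ] E')
    (h : ∀ i, ∃ (i' : ι') (g : F i → F' i'), Continuous g ∧ ∀ x, f (j i x) = j' i' (g x)) :
    @Continuous E E' (lcLimitTopology j) (lcLimitTopology j') f := by
  let t' : TopologicalSpace E' := lcLimitTopology j'
  -- The infimum of the admissible topologies on `E'` is itself admissible.
  have h1 : IsTopologicalAddGroup E' := topologicalAddGroup_sInf fun t ht => ht.1
  have h2 : ContinuousSMul ℂ E' := continuousSMul_sInf fun t ht => ht.2.1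
  have h3 : LocallyConvexSpace ℝ E' := LocallyConvexSpace.sInf fun t ht => ht.2.2.1
  have hj' : ∀ i, Continuous (j' i) := fun i => continuous_sInf_rng.2 fun t ht => ht.2.2.2 i
  -- The topology pulled back along `f` is a locally convex vector space topology on `E` and makes
  -- every `j i` continuous. It therefore belongs to the family defining the limit topology of `E`,
  -- which is finer than each member.
  rw [continuous_iff_le_induced]
  refine sInf_le ⟨topologicalAddGroup_induced f, continuousSMul_induced f,
    LocallyConvexSpace.induced (f.restrictScalars ℝ), fun i => continuous_induced_rng.2 ?_⟩
  obtain ⟨i', g, hg, hfg⟩ := h i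
  exact ((hj' i').comp hg).congr fun x => (hfg x).symm

/-! ### Pointwise bounds from the step norms -/

lemma sqrt_wt_mul_norm_coeff_le {lam β κ : ℝ} {q : ℕ} (Φ : HSpace lam β κ q) (n : ℕ) :
    √(wt κ q n) * ‖coeff lam β Φ.1 n‖ ≤ ‖Φ‖ := by
  have h := lp.norm_apply_le_norm (p := 2) (by norm_num) (HSpace.toLp lam β κ q Φ) n
  change ‖(√(wt κ q n) : ℂ) * coeff lam β Φ.1 n‖ ≤ ‖Φ‖ at h
  rwa [norm_mul, Complex.norm_real, Real.norm_of_nonneg (Real.sqrt_nonneg _)] at h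

lemma norm_le_norm_mul_exp {k : ℝ} {l : ℕ} (U : ESpace k l) (z : ℂ) :
    ‖U.1 z‖ ≤ ‖U‖ * Real.exp ((2 : ℝ) ^ l * ‖z‖ ^ k) := by
  have h := lp.norm_apply_le_norm (p := ∞) (by norm_num) (ESpace.toLp k l U) z
  change ‖U.1 z * (Real.exp (-((2 : ℝ) ^ l * ‖z‖ ^ k)) : ℂ)‖ ≤ ‖U‖ at h
  rwa [norm_mul, Complex.norm_real, Real.norm_of_nonneg (Real.exp_pos _).le, Real.exp_neg,
    ← div_eq_mul_inv, div_le_iff₀ (Real.exp_pos _)] at h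

lemma ESpace.norm_le {k : ℝ} {l : ℕ} (U : ESpace k l) {C : ℝ}
    (h : ∀ z : ℂ, ‖U.1 z‖ ≤ C * Real.exp ((2 : ℝ) ^ l * ‖z‖ ^ k)) : ‖U‖ ≤ C := by
  rw [ESpace.norm_eq]
  refine ciSup_le fun z => ?_
  rw [Real.exp_neg, ← div_eq_mul_inv, div_le_iff₀ (Real.exp_pos _)]
  exact h z

/-! ### From weights to growth -/

/-- The growth of the dual weights: `tⁿ / ((n!)^{1-κ} 2^{-nq})^{1/2} ≤ 2⁻ⁿ exp (2^l t^{k'})`. -/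
lemma exists_pow_le_sqrt_wt_mul_exp {κ : ℝ} (hκ0 : 0 ≤ κ) (hκ1 : κ < 1) (q : ℕ) :
    ∃ l : ℕ, ∀ (n : ℕ) (t : ℝ), 0 ≤ t →
      t ^ n ≤ √(wt κ q n) * ((1 / 2) ^ n * Real.exp ((2 : ℝ) ^ l * t ^ (2 / (1 - κ)))) := by
  have hα : 0 < 1 - κ := by linarith
  set α := 1 - κ with hα'
  set A : ℝ := (4 * 2 ^ q) ^ (1 / α) with hA
  have hA0 : 0 ≤ A := by positivity
  obtain ⟨l, hl⟩ := pow_unbounded_of_one_lt A (one_lt_two)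
  refine ⟨l, fun n t ht => ?_⟩
  have hn : (0 : ℝ) < n ! := by positivity
  have hy : 0 ≤ A * t ^ (2 / α) := by positivity
  -- The inequality `xⁿ / n! ≤ exp x` at `x = A t^{2/α}`, raised to the power `α`; this produces
  -- both `(n!)^α` and `t^{2n}`.
  have h1 := Real.rpow_le_rpow (by positivity)
    (Real.pow_div_factorial_le_exp (A * t ^ (2 / α)) hy n) hα.le
  have h2 : ((A * t ^ (2 / α)) ^ n) ^ α = (4 * 2 ^ q * t ^ 2) ^ n := by
    rw [← Real.rpow_natCast, ← Real.rpow_mul hy, mul_comm (n : ℝ) α, Real.rpow_mul hy, Real.rpow_natCast,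
      Real.mul_rpow hA0 (by positivity), hA, ← Real.rpow_mul (by positivity),
      ← Real.rpow_mul ht, one_div_mul_cancel hα.ne', div_mul_cancel₀ _ hα.ne', Real.rpow_one,
      Real.rpow_two]
  rw [Real.div_rpow (by positivity) hn.le, h2, ← Real.exp_mul,
    div_le_iff₀ (by positivity)] at h1
  have h3 : Real.exp (A * t ^ (2 / α) * α) ≤ Real.exp ((2 : ℝ) ^ l * t ^ (2 / α)) ^ 2 := by
    rw [← Real.exp_nat_mul]
    apply Real.exp_le_exp.2
    have h4 : A * t ^ (2 / α) ≤ 2 ^ l * t ^ (2 / α) := by gcongr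
    -- Here `0 ≤ κ` enters, as `α ≤ 1`.
    have h5 : A * t ^ (2 / α) * α ≤ A * t ^ (2 / α) * 1 := by gcongr; linarith
    push_cast
    linarith
  refine (sq_le_sq₀ (by positivity) (by positivity)).1 ?_
  rw [mul_pow, Real.sq_sqrt (wt_nonneg κ q n), mul_pow]
  calc (t ^ n) ^ 2 = (4 * 2 ^ q * t ^ 2) ^ n * ((2 ^ (n * q))⁻¹ * ((1 / 2) ^ n) ^ 2) := by
        rw [mul_pow, mul_pow, ← pow_mul 2 q n, mul_comm q n, ← pow_mul, ← pow_mul, ← pow_mul,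
          mul_comm n 2, pow_mul (1 / 2 : ℝ) 2 n]
        have : (4 : ℝ) ^ n * ((1 / 2) ^ 2) ^ n = 1 := by rw [← mul_pow]; norm_num
        have h2 : (2 : ℝ) ^ (n * q) * (2 ^ (n * q))⁻¹ = 1 := mul_inv_cancel₀ (by positivity)
        linear_combination (-t ^ (2 * n)) * this - (t ^ (2 * n) * 4 ^ n * ((1 / 2) ^ 2) ^ n) * h2
    _ ≤ (Real.exp ((2 : ℝ) ^ l * t ^ (2 / α)) ^ 2 * (n ! : ℝ) ^ α) *
          ((2 ^ (n * q))⁻¹ * ((1 / 2) ^ n) ^ 2) := by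
        gcongr
        exact h1.trans (by gcongr)
    _ = _ := by rw [wt]; ring

/-! ### Taylor coefficients and Cauchy's estimate -/

/-- The `n`-th Taylor coefficient at `0`. -/
noncomputable def taylorCoeff (U : ℂ → ℂ) (n : ℕ) : ℂ := iteratedDeriv n U 0 / n !

lemma hasSum_taylorCoeff {U : ℂ → ℂ} (hU : Differentiable ℂ U) (z : ℂ) :
    HasSum (fun n => taylorCoeff U n * z ^ n) (U z) := by
  have h := Complex.hasSum_taylorSeries_of_entire hU 0 z
  refine h.congr_fun fun n => ?_
  simp only [taylorCoeff, sub_zero, smul_eq_mul]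
  ring

/-- Cauchy's estimate on the circle of radius `(n + 1)^{(1-κ)/2}`. -/
lemma exists_wt_mul_norm_taylorCoeff_sq_le {κ : ℝ} (hκ1 : κ < 1) (l : ℕ) :
    ∃ (q : ℕ) (D : ℝ), 0 ≤ D ∧ ∀ (U : ESpace (2 / (1 - κ)) l) (n : ℕ),
      wt κ q n * ‖taylorCoeff U.1 n‖ ^ 2 ≤ (D * ‖U‖) ^ 2 * (1 / 2) ^ n := by
  have hα : 0 < 1 - κ := by linarith
  set D : ℝ := Real.exp (2 ^ l) with hD
  have hD0 : 0 < D := Real.exp_pos _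
  -- Cauchy's estimate will cost `D ^ (2 * n)` up to a constant; this `q` lets `2^{-nq}` absorb it
  -- and leave `(1 / 2) ^ n`.
  obtain ⟨q, hq⟩ := pow_unbounded_of_one_lt (2 * D ^ 2) (one_lt_two)
  refine ⟨q, D, hD0.le, fun U n => ?_⟩
  have hn : (0 : ℝ) < n ! := by positivity
  -- Minimizing `exp (2^l R^{k'}) / Rⁿ` makes `R^{k'}` proportional to `n`. Taking `n + 1` keeps the
  -- radius positive at `n = 0`, and the exponential on the circle becomes `D ^ (n + 1)`.
  set R : ℝ := ((n : ℝ) + 1) ^ ((1 - κ) / 2) with hR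
  have hR0 : 0 < R := by positivity
  have hRk : R ^ (2 / (1 - κ)) = n + 1 := by
    rw [hR, ← Real.rpow_mul (by positivity), div_mul_div_cancel₀ two_ne_zero, div_self hα.ne',
      Real.rpow_one]
  have hb : ‖taylorCoeff U.1 n‖ ≤ ‖U‖ * D ^ (n + 1) / R ^ n := by
    have h := Complex.norm_iteratedDeriv_le_of_forall_mem_sphere_norm_le (c := 0) (f := U.1)
      (C := ‖U‖ * D ^ (n + 1)) n hR0 (Differentiable.diffContOnCl U.2.1) fun z hz => by
        have hz' : ‖z‖ = R := by simpa using hz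
        refine (norm_le_norm_mul_exp U z).trans_eq ?_
        rw [hz', hRk, hD, ← Real.exp_nat_mul]
        push_cast
        ring_nf
    rw [taylorCoeff, norm_div, RCLike.norm_natCast, div_le_iff₀ hn]
    refine h.trans_eq ?_
    ring
  -- The denominator in Cauchy's estimate compensates the factorial in the weight, since `n! ≤ (n +
  -- 1)ⁿ`.
  have hfac : (n ! : ℝ) ^ (1 - κ) ≤ (R ^ n) ^ 2 := by
    have h1 : (n ! : ℝ) ≤ ((n : ℝ) + 1) ^ n := by
      exact_mod_cast n.factorial_le_pow.trans (Nat.pow_le_pow_left n.le_succ n)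
    refine (Real.rpow_le_rpow hn.le h1 hα.le).trans_eq ?_
    rw [hR, ← pow_mul, ← Real.rpow_natCast, ← Real.rpow_natCast, ← Real.rpow_mul (by positivity),
      ← Real.rpow_mul (by positivity)]
    congr 1
    push_cast
    ring
  have hsq : ‖taylorCoeff U.1 n‖ ^ 2 * (n ! : ℝ) ^ (1 - κ) ≤ (‖U‖ * D ^ (n + 1)) ^ 2 := by
    rw [le_div_iff₀ (by positivity)] at hb
    calc _ ≤ ‖taylorCoeff U.1 n‖ ^ 2 * (R ^ n) ^ 2 := by gcongr
      _ = (‖taylorCoeff U.1 n‖ * R ^ n) ^ 2 := by ring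
      _ ≤ _ := by gcongr
  have hgeo : (D ^ 2) ^ n * ((2 : ℝ) ^ (n * q))⁻¹ ≤ (1 / 2) ^ n := by
    rw [mul_comm n q, pow_mul, ← inv_pow, ← mul_pow]
    refine pow_le_pow_left₀ (by positivity) ?_ n
    rw [← div_eq_mul_inv, div_le_iff₀ (by positivity)]
    linarith
  calc wt κ q n * ‖taylorCoeff U.1 n‖ ^ 2
      = (‖taylorCoeff U.1 n‖ ^ 2 * (n ! : ℝ) ^ (1 - κ)) * ((2 : ℝ) ^ (n * q))⁻¹ := by
        rw [wt]; ring
    _ ≤ (‖U‖ * D ^ (n + 1)) ^ 2 * ((2 : ℝ) ^ (n * q))⁻¹ := by gcongr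
    _ = (D * ‖U‖) ^ 2 * ((D ^ 2) ^ n * ((2 : ℝ) ^ (n * q))⁻¹) := by ring
    _ ≤ _ := by gcongr

/-- A power series converging absolutely on `ℂ` is entire and has the expected Taylor
coefficients. -/
lemma entire_of_hasSum {a : ℕ → ℂ} {U : ℂ → ℂ} (hU : ∀ z, HasSum (fun n => a n * z ^ n) (U z)) :
    Differentiable ℂ U ∧ taylorCoeff U = a := by
  set p := FormalMultilinearSeries.ofScalars ℂ a with hp
  -- Convergence at every nonnegative real point already forces an infinite radius.
  have hr : p.radius = ⊤ := p.radius_eq_top_of_summable_norm fun r => by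
    have := (hU (r : ℝ)).summable.norm
    refine this.congr fun n => ?_
    simp [hp]
  have hball : HasFPowerSeriesOnBall U p 0 ⊤ := by
    refine ⟨hr.ge, by simp, fun {y} _ => ?_⟩
    rw [zero_add]
    refine (hU y).congr_fun fun n => ?_
    rw [FormalMultilinearSeries.apply_eq_prod_smul_coeff]
    simp [hp, FormalMultilinearSeries.coeff_ofScalars, mul_comm]
  refine ⟨fun z => (hball.differentiableOn z (by simp)).differentiableAt (by simp), ?_⟩
  have han := hball.analyticAt.hasFPowerSeriesAt
  -- Uniqueness of the power series at `0` identifies the Taylor series with `a`.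
  have heq := han.eq_formalMultilinearSeries hball.hasFPowerSeriesAt
  ext n
  have := congrArg (fun p => FormalMultilinearSeries.coeff p n) heq
  simpa [hp, FormalMultilinearSeries.coeff_ofScalars, taylorCoeff] using this

/-! ### The transform as a power series -/

/-- The factorial of the pairing cancels that of `wickCoeff`. This reduces every later statement
about the transform to one about power series. -/
lemma hasSum_sTransformLog {lam β κ : ℝ} (hκ1 : κ < 1) (Φ : GenFun lam β κ) (z : ℂ) :
    HasSum (fun n => coeff lam β Φ.1 n * z ^ n) (sTransformLog lam β Φ.1 z) := by
  refine (summable_pairing (wickCoeff_mem hκ1 z) Φ).hasSum.congr_fun fun n => ?_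
  have : (n ! : ℂ) ≠ 0 := by exact_mod_cast n.factorial_ne_zero
  rw [wickCoeff]
  field_simp

/-- Each term of the power series is at most `2⁻ⁿ` times a common bound, by the weight estimate.
Since `l` depends on `q` alone, this is boundedness from one step to one step. -/
lemma exists_norm_sTransformLog_le {lam β κ : ℝ} (hκ0 : 0 ≤ κ) (hκ1 : κ < 1) (q : ℕ) :
    ∃ l : ℕ, ∀ (Φ : HSpace lam β κ q) (z : ℂ), ‖sTransformLog lam β Φ.1 z‖ ≤
      2 * ‖Φ‖ * Real.exp ((2 : ℝ) ^ l * ‖z‖ ^ (2 / (1 - κ))) := by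
  obtain ⟨l, hl⟩ := exists_pow_le_sqrt_wt_mul_exp hκ0 hκ1 q
  refine ⟨l, fun Φ z => ?_⟩
  have hs := hasSum_sTransformLog hκ1 (HSpace.incl lam β κ q Φ) z
  change HasSum _ (sTransformLog lam β Φ.1 z) at hs
  rw [← hs.tsum_eq]
  refine tsum_of_norm_bounded
    (hasSum_geometric_two.mul_left (‖Φ‖ * Real.exp ((2 : ℝ) ^ l * ‖z‖ ^ (2 / (1 - κ)))))
    (fun n => ?_) |>.trans_eq (by ring)
  rw [norm_mul, norm_pow]
  calc ‖coeff lam β Φ.1 n‖ * ‖z‖ ^ n ≤ ‖coeff lam β Φ.1 n‖ * (√(wt κ q n) *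
        ((1 / 2) ^ n * Real.exp ((2 : ℝ) ^ l * ‖z‖ ^ (2 / (1 - κ))))) := by
        gcongr; exact hl n ‖z‖ (norm_nonneg z)
    _ = (√(wt κ q n) * ‖coeff lam β Φ.1 n‖) *
        ((1 / 2) ^ n * Real.exp ((2 : ℝ) ^ l * ‖z‖ ^ (2 / (1 - κ)))) := by ring
    _ ≤ ‖Φ‖ * ((1 / 2) ^ n * Real.exp ((2 : ℝ) ^ l * ‖z‖ ^ (2 / (1 - κ)))) := by
        gcongr; exact sqrt_wt_mul_norm_coeff_le Φ n
    _ = _ := by ring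

/-- The `S`-transform in the coordinate `z = exp w - 1`, as a map between the steps. -/
noncomputable def sTransformStep {lam β κ : ℝ} (hκ1 : κ < 1) {q l : ℕ}
    (h : ∀ (Φ : HSpace lam β κ q) (z : ℂ), ‖sTransformLog lam β Φ.1 z‖ ≤
      2 * ‖Φ‖ * Real.exp ((2 : ℝ) ^ l * ‖z‖ ^ (2 / (1 - κ)))) :
    HSpace lam β κ q →+ ESpace (2 / (1 - κ)) l :=
  AddMonoidHom.mk' (fun Φ => ⟨sTransformLog lam β Φ.1,
    (entire_of_hasSum (hasSum_sTransformLog hκ1 (HSpace.incl lam β κ q Φ))).1,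
    -- The summand `1` is there because membership asks for a strictly positive constant, even when
    -- `‖Φ‖ = 0`.
    2 * ‖Φ‖ + 1, by positivity, fun z => (h Φ z).trans (by gcongr; linarith)⟩) fun Φ Ψ => by
      refine Subtype.ext (funext fun z => ?_)
      have h1 := hasSum_sTransformLog hκ1 (HSpace.incl lam β κ q Φ) z
      have h2 := hasSum_sTransformLog hκ1 (HSpace.incl lam β κ q Ψ) z
      have h3 := hasSum_sTransformLog hκ1 (HSpace.incl lam β κ q (Φ + Ψ)) z
      refine h3.unique ((h1.add h2).congr_fun fun n => ?_)
      change coeff lam β (Φ.1 + Ψ.1) n * _ = coeff lam β Φ.1 n * _ + coeff lam β Ψ.1 n * _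
      rw [coeff_add, add_mul]

/-- The `S`-transform in the coordinate `z = exp w - 1`, from `(N)^{-κ}` to `ℰ^{k'}_max(ℂ)`. -/
noncomputable def sTransformMap {lam β κ : ℝ} (hκ0 : 0 ≤ κ) (hκ1 : κ < 1) :
    GenFun lam β κ →ₗ[ℂ] EMax (2 / (1 - κ)) where
  toFun Φ := ⟨sTransformLog lam β Φ.1, by
    obtain ⟨q, hq⟩ := Φ.2
    obtain ⟨l, hl⟩ := exists_norm_sTransformLog_le (lam := lam) (β := β) hκ0 hκ1 q
    exact ⟨l, (sTransformStep hκ1 hl ⟨Φ.1, hq⟩).2⟩⟩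
  map_add' Φ Ψ := by
    refine Subtype.ext (funext fun z => ?_)
    refine (hasSum_sTransformLog hκ1 (Φ + Ψ) z).unique
      (((hasSum_sTransformLog hκ1 Φ z).add (hasSum_sTransformLog hκ1 Ψ z)).congr_fun fun n => ?_)
    change coeff lam β (Φ.1 + Ψ.1) n * _ = _
    rw [coeff_add, add_mul]
  map_smul' c Φ := by
    refine Subtype.ext (funext fun z => ?_)
    refine (hasSum_sTransformLog hκ1 (c • Φ) z).unique
      (((hasSum_sTransformLog hκ1 Φ z).mul_left c).congr_fun fun n => ?_)
    change coeff lam β (c • Φ.1) n * _ = _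
    rw [coeff_smul, mul_assoc]

/-! ### Injectivity and surjectivity -/

lemma taylorCoeff_sTransformLog {lam β κ : ℝ} (hκ1 : κ < 1) (Φ : GenFun lam β κ) :
    taylorCoeff (sTransformLog lam β Φ.1) = coeff lam β Φ.1 :=
  (entire_of_hasSum (hasSum_sTransformLog hκ1 Φ)).2

/-- The `Cₙ` span the polynomials, so a functional is determined by its values on them. -/
lemma coeff_injective {lam β : ℝ} (hlam : 0 < lam) (hβ : 0 < β) :
    Function.Injective (coeff lam β) := by
  intro Φ Ψ h
  refine LinearMap.ext_on_range (span_genAppell hlam hβ) fun n => ?_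
  have hn : (n ! : ℂ) ≠ 0 := by exact_mod_cast n.factorial_ne_zero
  have := congrFun h n
  rwa [coeff, coeff, div_left_inj' hn] at this

/-- As `deg Cₙ = n`, the `Cₙ` form a basis, and an algebraic functional can be prescribed freely on
a basis. -/
lemma coeff_surjective {lam β : ℝ} (hlam : 0 < lam) (hβ : 0 < β) :
    Function.Surjective (coeff lam β) := by
  intro a
  let S : Polynomial.Sequence ℂ := ⟨genAppell lam β, degree_genAppell hlam hβ⟩
  let b := S.basis fun i =>
    (Polynomial.leadingCoeff_ne_zero.2 (Polynomial.Sequence.ne_zero _ i)).isUnit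
  refine ⟨b.constr ℂ fun n => (n ! : ℂ) * a n, funext fun n => ?_⟩
  have hn : (n ! : ℂ) ≠ 0 := by exact_mod_cast n.factorial_ne_zero
  have hb : b n = genAppell lam β n := S.basis_eq_self _ n
  rw [coeff, ← hb, Module.Basis.constr_basis, mul_div_cancel_left₀ _ hn]

lemma summable_wt_mul_norm_taylorCoeff_sq {κ : ℝ} {q l : ℕ} {D : ℝ}
    (h : ∀ (U : ESpace (2 / (1 - κ)) l) (n : ℕ),
      wt κ q n * ‖taylorCoeff U.1 n‖ ^ 2 ≤ (D * ‖U‖) ^ 2 * (1 / 2) ^ n)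
    (U : ESpace (2 / (1 - κ)) l) : Summable fun n => wt κ q n * ‖taylorCoeff U.1 n‖ ^ 2 :=
  Summable.of_nonneg_of_le (fun n => mul_nonneg (wt_nonneg κ q n) (by positivity)) (h U)
    (hasSum_geometric_two.summable.mul_left _)

/-- Taylor coefficients recover those of `Φ`, hence injectivity. For surjectivity, the functional
whose coefficients are the Taylor coefficients of `U` lies in some `(H)_{-q}^{-κ}` by Cauchy's
estimate. -/
lemma sTransformMap_bijective {lam β κ : ℝ} (hlam : 0 < lam) (hβ : 0 < β) (hκ0 : 0 ≤ κ)
    (hκ1 : κ < 1) : Function.Bijective (sTransformMap (lam := lam) (β := β) hκ0 hκ1) := by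
  constructor
  · intro Φ Ψ h
    have h' : sTransformLog lam β Φ.1 = sTransformLog lam β Ψ.1 := congrArg Subtype.val h
    refine Subtype.ext (coeff_injective hlam hβ ?_)
    rw [← taylorCoeff_sTransformLog hκ1 Φ, h', taylorCoeff_sTransformLog hκ1 Ψ]
  · rintro ⟨U, l, hU⟩
    obtain ⟨q, D, -, hD⟩ := exists_wt_mul_norm_taylorCoeff_sq_le hκ1 l
    obtain ⟨Φ, hΦ⟩ := coeff_surjective hlam hβ (taylorCoeff U)
    have hmem : Φ ∈ hSubmodule lam β κ q := by
      change Summable _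
      rw [hΦ]
      exact summable_wt_mul_norm_taylorCoeff_sq hD ⟨U, hU⟩
    refine ⟨⟨Φ, q, hmem⟩, Subtype.ext (funext fun z => ?_)⟩
    have h := hasSum_sTransformLog hκ1 (⟨Φ, q, hmem⟩ : GenFun lam β κ) z
    refine h.unique ?_
    change HasSum (fun n => coeff lam β Φ n * z ^ n) (U z)
    rw [hΦ]
    exact hasSum_taylorCoeff hU.1 z

/-! ### Continuity in both directions -/

lemma continuous_sTransformMap {lam β κ : ℝ} (hκ0 : 0 ≤ κ) (hκ1 : κ < 1) :
    Continuous (sTransformMap (lam := lam) (β := β) hκ0 hκ1) := by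
  refine continuous_lcLimitTopology _ _ _ fun q => ?_
  obtain ⟨l, hl⟩ := exists_norm_sTransformLog_le (lam := lam) (β := β) hκ0 hκ1 q
  exact ⟨l, sTransformStep hκ1 hl, AddMonoidHomClass.continuous_of_bound _ 2 fun Φ =>
    ESpace.norm_le _ (hl Φ), fun Φ => rfl⟩

/-- No open mapping theorem is needed: on step `l` the inverse reads off Taylor coefficients, and
Cauchy's estimate bounds it explicitly into a single step `q`. -/
lemma continuous_sTransformMap_symm {lam β κ : ℝ} (hlam : 0 < lam) (hβ : 0 < β) (hκ0 : 0 ≤ κ)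
    (hκ1 : κ < 1) : Continuous (LinearEquiv.ofBijective
      (sTransformMap (lam := lam) (β := β) hκ0 hκ1)
      (sTransformMap_bijective hlam hβ hκ0 hκ1)).symm := by
  set T := LinearEquiv.ofBijective (sTransformMap (lam := lam) (β := β) hκ0 hκ1)
    (sTransformMap_bijective hlam hβ hκ0 hκ1) with hT
  refine continuous_lcLimitTopology _ _ T.symm.toLinearMap fun l => ?_
  obtain ⟨q, D, hD0, hD⟩ := exists_wt_mul_norm_taylorCoeff_sq_le hκ1 l
  have hcoeff : ∀ U : ESpace (2 / (1 - κ)) l,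
      coeff lam β (T.symm (ESpace.incl _ l U)).1 = taylorCoeff U.1 := fun U => by
    rw [← taylorCoeff_sTransformLog hκ1]
    exact congrArg (fun V : EMax (2 / (1 - κ)) => taylorCoeff V.1)
      (T.apply_symm_apply (ESpace.incl _ l U))
  let g : ESpace (2 / (1 - κ)) l →+ HSpace lam β κ q :=
    AddMonoidHom.mk' (fun U => ⟨(T.symm (ESpace.incl _ l U)).1, by
      change Summable _
      rw [hcoeff]
      exact summable_wt_mul_norm_taylorCoeff_sq hD U⟩) fun U V =>
        Subtype.ext (congrArg (fun Φ : GenFun lam β κ => Φ.1)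
          (T.symm.map_add (ESpace.incl _ l U) (ESpace.incl _ l V)))
  -- The geometric series gives `‖g U‖² ≤ 2 (D ‖U‖)²`, so `√2 * D` would do; `2 * D` avoids the
  -- root.
  refine ⟨q, g, AddMonoidHomClass.continuous_of_bound g (2 * D) fun U => ?_, fun U => rfl⟩
  refine (sq_le_sq₀ (by positivity) (by positivity)).1 ?_
  rw [HSpace.norm_sq]
  change ∑' n, wt κ q n * ‖coeff lam β (T.symm (ESpace.incl _ l U)).1 n‖ ^ 2 ≤ _
  rw [hcoeff]
  have h1 := hasSum_geometric_two.mul_left ((D * ‖U‖) ^ 2)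
  have h2 := (summable_wt_mul_norm_taylorCoeff_sq hD U).tsum_le_tsum (hD U) h1.summable
  rw [h1.tsum_eq] at h2
  nlinarith [sq_nonneg (D * ‖U‖)]

end FracPoisson

theorem mainTheorem2 (lam β κ : ℝ) (hlam : 0 < lam) (hβ0 : 0 < β) (hβ1 : β ≤ 1)
    (hκ0 : 0 ≤ κ) (hκ1 : κ < 1) :
    ∃ T : FracPoisson.GenFun lam β κ ≃L[ℂ] FracPoisson.EMax (2 / (1 - κ)),
      ∀ Φ : FracPoisson.GenFun lam β κ,
        (∀ z : ℂ, (T Φ).1 z = FracPoisson.sTransformLog lam β Φ.1 z) ∧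
        (∀ w : ℂ, FracPoisson.sTransform lam β Φ.1 w = (T Φ).1 (Complex.exp w - 1)) :=
  ⟨{ toLinearEquiv := LinearEquiv.ofBijective (FracPoisson.sTransformMap hκ0 hκ1)
        (FracPoisson.sTransformMap_bijective hlam hβ0 hκ0 hκ1)
     continuous_toFun := FracPoisson.continuous_sTransformMap hκ0 hκ1
     continuous_invFun := FracPoisson.continuous_sTransformMap_symm hlam hβ0 hκ0 hκ1 },
    -- `sTransform` at `w` and `sTransformLog` at `exp w - 1` are the same pairing by definition.
    fun _ => ⟨fun _ => rfl, fun _ => rfl⟩⟩
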